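/- The graph families $\mathcal G_d$ ($d\ge 2$) are defined inductively; each member is a finite bipartite graph with a fixed partition $(A,B)$ of its vertices into two independent sets of equal size. The members of $\mathcal G_2$ are the cycles $v_1v_2\cdots v_n$ with $n\ge 5$ and $n$ even, where $A$ consists of the vertices with odd index and $B$ of those with even index. The members of $\mathcal G_{d+1}$ are obtained as follows: take a member $G$ of $\mathcal G_d$ with partition $(A,B)$, an integer $n\ge 5$, and $n$ disjoint copies $G^1,\dots,G^n$ of $G$ with partitions $(A^i,B^i)$; put $G^{n+1}=G^1$ and $A^{n+1}=A^1$, and for each $i=1,\dots,n$ add the edges of an arbitrary perfect matching (1-factor) between $B^i$ and $A^{i+1}$. The partition of the new graph is $\bigl(\bigcup_i A^i,\bigcup_i B^i\bigr)$. **Theorem.** For every integer $d\ge 2$ and every integer $g\ge 0$, the family $\mathcal G_d$ contains a graph of girth greater than $g$. This graph is finite, $d$-regular and bipartite; it contains a cycle, and each of its cycles has length greater than $g$. -/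

import Mathlib

/-- Take `n` copies of `G`, indexed cyclically by `ZMod n`; the copy of `v` in the `i`-th copy is
`(i, v)`.  Keep the edges of `G` inside each copy, and for each `i` add the 1-factor
between the copy of `B` in the `i`-th copy and the copy of `A` in the `(i+1)`-st copy that is given
by the bijection `f i : B ≃ A`.  The bijections `f i` may be different for different `i`. -/
def cyclicJoin {V : Type} (n : ℕ) (G : SimpleGraph V) (A B : Set V) (f : ZMod n → (B ≃ A)) :
    SimpleGraph (ZMod n × V) :=
  SimpleGraph.fromRel fun x y =>
    (x.1 = y.1 ∧ G.Adj x.2 y.2) ∨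
      (y.1 = x.1 + 1 ∧ ∃ h : x.2 ∈ B, (f x.1 ⟨x.2, h⟩ : V) = y.2)

/-- `Constructed d G A B`: the graph `G` together with the partition `(A, B)` of its vertices is a
possible value of `G_d` together with `(A_d, B_d)` in the inductive construction.
The vertices `v_1, …, v_n` of the starting cycle are `0, …, n - 1` in `Fin n`, so the vertices
with odd index are those with even value. -/
inductive Constructed : ℕ → {V : Type} → SimpleGraph V → Set V → Set V → Prop
  | cycle (n : ℕ) (hn : 5 ≤ n) (heven : Even n) :
      Constructed 2 (SimpleGraph.cycleGraph n) {v | Even v.val} {v | Odd v.val}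
  | step (d : ℕ) {V : Type} (G : SimpleGraph V) (A B : Set V) (hG : Constructed d G A B)
      (n : ℕ) (hn : 5 ≤ n) (f : ZMod n → (B ≃ A)) :
      Constructed (d + 1) (cyclicJoin n G A B f) {x | x.2 ∈ A} {x | x.2 ∈ B}

/-- The graph `G` belongs (up to isomorphism) to the family `𝒢_d`. -/
def InFamily (d : ℕ) {V : Type} (G : SimpleGraph V) : Prop :=
  ∃ (W : Type) (H : SimpleGraph W) (A B : Set W), Constructed d H A B ∧ Nonempty (G ≃g H)

/-! Induction on `d`, with the classes also required to be arbitrarily large; long even cycles start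
it. In the inductive step, five copies of a graph of girth greater than `g` are joined, and the
matchings are improved by switching. Suppose the join has girth greater than `m`, with `m < g`. A
cycle of length `m + 1` cannot stay inside one copy, so it uses a link between copies, say `b a`.
Balls of radius `m` have size bounded in terms of the degree, so a large class `B` provides a link
`b' a'` of the same matching far from `b a` (`exists_far_link`). Replace the two by `b a'` and `b'
a`.

No new short cycle arises (`notMem_edges_of_switch`): following one from `b` without `b a'`, the old
edges lead to `a'`, `b'` or `a`. The first two are too far away, and reaching `a` without the edge
`b a` costs at least `m`. Hence the set of links on short cycles loses `(i, b)` and gains nothing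
(`lt_egirth_and_shortLinks_switch`). Repeating this empties the set, and then `m` can be raised
(`exists_lt_egirth_cyclicJoin`). -/

namespace SimpleGraph

variable {V : Type*} {G H K : SimpleGraph V}

/-! ### Girth, closed trails and switching -/

/-- In a graph of girth greater than `m`, the ends of an edge are at distance at least `m` once the
edge is removed. -/
lemma le_length_of_lt_egirth {m : ℕ} (hm : (m : ℕ∞) < G.egirth) {u v : V} (h : G.Adj u v)
    (p : G.Walk u v) (hp : s(u, v) ∉ p.edges) : m ≤ p.length := by
  classical
  have hc : (Walk.cons h.symm p.bypass).IsCycle := by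
    rw [Walk.cons_isCycle_iff]
    refine ⟨p.bypass_isPath, fun hmem => hp ?_⟩
    rw [Sym2.eq_swap]
    exact p.edges_bypass_subset_edges hmem
  have h1 := hm.trans_le (egirth_le_length hc)
  have h2 := p.length_bypass_le_length
  rw [Walk.length_cons] at h1
  norm_cast at h1
  omega

/-- A walk can be cut at any of its edges. -/
lemma Walk.exists_eq_append_cons {x y u v : V} (p : G.Walk x y) (h : s(u, v) ∈ p.edges) :
    ∃ (a b : V) (hab : G.Adj a b) (q : G.Walk x a) (r : G.Walk b y),
      s(a, b) = s(u, v) ∧ p = q.append (cons hab r) := by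
  induction p with
  | nil => simp at h
  | @cons x z y hxz p ih =>
    rw [edges_cons, List.mem_cons] at h
    rcases h with h | h
    · exact ⟨x, z, hxz, nil, p, h.symm, rfl⟩
    · obtain ⟨a, b, hab, q, r, he, rfl⟩ := ih h
      exact ⟨a, b, hab, cons hxz q, r, he, rfl⟩

/-- Removing an edge from a closed trail leaves a walk between the ends of the edge. -/
lemma Walk.IsTrail.exists_walk_of_mem_edges {x u v : V} {c : G.Walk x x} (hc : c.IsTrail)
    (h : s(u, v) ∈ c.edges) :
    ∃ p : G.Walk u v, s(u, v) ∉ p.edges ∧ p.length + 1 = c.length := by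
  obtain ⟨a, b, hab, q, r, he, rfl⟩ := c.exists_eq_append_cons h
  have hn := hc.edges_nodup
  rw [edges_append, edges_cons, List.nodup_append, List.nodup_cons] at hn
  have key : ∃ p : G.Walk b a, s(a, b) ∉ p.edges ∧ p.length + 1 = (q.append (cons hab r)).length := by
    refine ⟨r.append q, ?_, ?_⟩
    · rw [edges_append, List.mem_append, not_or]
      exact ⟨hn.2.1.1, fun hq => hn.2.2 _ hq _ List.mem_cons_self rfl⟩
    · simp only [length_append, length_cons]; omega
  obtain ⟨p, hp, hl⟩ := key
  rw [he] at hp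
  rcases Sym2.eq_iff.1 he with ⟨rfl, rfl⟩ | ⟨rfl, rfl⟩
  · exact ⟨p.reverse, by simpa using hp, by simpa using hl⟩
  · exact ⟨p, hp, hl⟩

/-- It suffices for large girth that the ends of each edge are far apart without the edge. -/
lemma lt_egirth_of_forall_le_length {m : ℕ}
    (h : ∀ u v, G.Adj u v → ∀ p : G.Walk u v, s(u, v) ∉ p.edges → m ≤ p.length) :
    (m : ℕ∞) < G.egirth := by
  refine lt_of_lt_of_le (b := ((m + 1 : ℕ) : ℕ∞)) (by norm_cast; omega) (le_egirth.2 ?_)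
  intro x c hc
  cases c with
  | nil => exact absurd rfl hc.ne_nil
  | @cons _ y _ hxy c =>
    obtain ⟨p, hp, hl⟩ := hc.isTrail.exists_walk_of_mem_edges (u := x) (v := y) (by simp)
    have := h x y hxy p hp
    rw [← hl]
    norm_cast
    omega

/-- A walk in a graph with two more edges `e` and `s(z, w)` than `K` that avoids `e`
is a walk in `K`, or it starts with a walk in `K` to an end of `s(z, w)`. -/
lemma Walk.exists_walk_or_exists_walk {e : Sym2 V} {z w : V}
    (h : ∀ x y, H.Adj x y → K.Adj x y ∨ s(x, y) = s(z, w) ∨ s(x, y) = e) {x y : V}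
    (p : H.Walk x y) (hp : e ∉ p.edges) :
    (∃ q : K.Walk x y, q.length = p.length) ∨
      ∃ t, (t = z ∨ t = w) ∧ ∃ q : K.Walk x t, q.length < p.length := by
  induction p with
  | nil => exact Or.inl ⟨nil, rfl⟩
  | @cons x u y hxu p ih =>
    rw [edges_cons, List.mem_cons, not_or] at hp
    rcases h x u hxu with hK | he | he
    · rcases ih hp.2 with ⟨q, hq⟩ | ⟨t, ht, q, hq⟩
      · exact Or.inl ⟨cons hK q, by simp [hq]⟩
      · exact Or.inr ⟨t, ht, cons hK q, by simpa using hq⟩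
    · refine Or.inr ⟨x, ?_, nil, by simp⟩
      rcases Sym2.eq_iff.1 he with ⟨rfl, -⟩ | ⟨rfl, -⟩ <;> simp
    · exact absurd he.symm hp.1

/-- If the edges `s(b, a)` and `s(b', a')` of a graph of girth greater than `m` are far apart and
are switched to `s(b, a')` and `s(b', a)`, then the new edge `s(b, a')` lies on no closed trail
of length at most `m + 1`. -/
lemma notMem_edges_of_switch {m : ℕ} (hm : (m : ℕ∞) < G.egirth) {a b a' b' : V}
    (hba : G.Adj b a)
    (hH : ∀ x y, H.Adj x y → (G.Adj x y ∧ s(x, y) ≠ s(b, a)) ∨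
      s(x, y) = s(b', a) ∨ s(x, y) = s(b, a'))
    (hbb : ∀ p : G.Walk b b', m < p.length) (hba' : ∀ p : G.Walk b a', m < p.length)
    {x : V} {c : H.Walk x x} (hc : c.IsTrail) (hl : c.length ≤ m + 1) :
    s(b, a') ∉ c.edges := by
  intro hmem
  obtain ⟨p, hp, hpl⟩ := hc.exists_walk_of_mem_edges hmem
  have hH' : ∀ x y, H.Adj x y → (G.deleteEdges {s(b, a)}).Adj x y ∨
      s(x, y) = s(b', a) ∨ s(x, y) = s(b, a') := by
    simpa [deleteEdges_adj] using hH
  have hle : G.deleteEdges {s(b, a)} ≤ G := deleteEdges_le _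
  -- Here `p` has length at most `m`. If it meets the other new edge, the part before is strictly
  -- shorter; this strictness matters for the end `a`, where only the bound `m ≤ q.length` is
  -- available.
  rcases p.exists_walk_or_exists_walk hH' hp with ⟨q, hq⟩ | ⟨t, rfl | rfl, q, hq⟩
  · have := hba' (q.mapLe hle)
    simp at this
    omega
  · have := hbb (q.mapLe hle)
    simp at this
    omega
  · have := le_length_of_lt_egirth hm hba (q.mapLe hle) (by
      intro h
      rw [Walk.edges_mapLe_eq_edges] at h
      have := q.edges_subset_edgeSet h
      simp [edgeSet_deleteEdges] at this)
    simp at this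
    omega

/-! ### Sizes of balls -/

/-- The number of vertices at distance at most `r` from `x`, for bounded degrees. -/
lemma ncard_setOf_exists_walk_le [Finite V] {D : ℕ} (hD : ∀ v, (G.neighborSet v).ncard ≤ D)
    (r : ℕ) (x : V) : {y | ∃ p : G.Walk x y, p.length ≤ r}.ncard ≤ (D + 1) ^ r := by
  induction r generalizing x with
  | zero =>
    have : {y | ∃ p : G.Walk x y, p.length ≤ 0} ⊆ {x} := by
      rintro y ⟨p, hp⟩
      cases p with
      | nil => rfl
      | cons h p => simp at hp
    exact (Set.ncard_le_ncard this).trans (by simp)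
  | succ r ih =>
    have hsub : {y | ∃ p : G.Walk x y, p.length ≤ r + 1} ⊆
        {x} ∪ ⋃ z ∈ G.neighborSet x, {y | ∃ p : G.Walk z y, p.length ≤ r} := by
      rintro y ⟨p, hp⟩
      cases p with
      | nil => simp
      | cons h p =>
        right
        simp only [Set.mem_iUnion]
        exact ⟨_, h, p, by simpa using hp⟩
    have hN : (⋃ z ∈ G.neighborSet x, {y | ∃ p : G.Walk z y, p.length ≤ r}).ncard ≤
        D * (D + 1) ^ r := by
      classical
      have hf := (G.neighborSet x).toFinite
      have h1 := Finset.set_ncard_biUnion_le hf.toFinset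
        (fun z => {y | ∃ p : G.Walk z y, p.length ≤ r})
      simp only [Set.Finite.mem_toFinset] at h1
      refine h1.trans ((Finset.sum_le_card_nsmul _ _ _ fun z _ => ih z).trans ?_)
      rw [← Set.ncard_eq_toFinset_card _ hf, smul_eq_mul]
      exact Nat.mul_le_mul_right _ (hD x)
    refine (Set.ncard_le_ncard hsub).trans ((Set.ncard_union_le _ _).trans ?_)
    rw [Set.ncard_singleton, pow_succ]
    have : 1 ≤ (D + 1) ^ r := Nat.one_le_pow _ _ (by omega)
    nlinarith

/-! ### Girth of cycles -/

lemma cycleGraph_adj_iff_val {n : ℕ} (hn : 3 ≤ n) {u v : Fin n} :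
    (cycleGraph n).Adj u v ↔ (v.val = u.val + 1 ∨ u.val = v.val + 1 ∨
      (u.val = 0 ∧ v.val + 1 = n) ∨ (v.val = 0 ∧ u.val + 1 = n)) := by
  rw [cycleGraph_adj']
  have hu := u.2
  have hv := v.2
  rw [Fin.sub_def, Fin.sub_def]
  simp only
  have h1 : ∀ a b : ℕ, a < n → b < n → (n - b + a) % n = if b ≤ a then a - b else n - b + a := by
    intro a b ha hb
    split_ifs with h
    · rw [show n - b + a = (a - b) + n by omega, Nat.add_mod_right, Nat.mod_eq_of_lt (by omega)]
    · exact Nat.mod_eq_of_lt (by omega)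
  rw [h1 _ _ hu hv, h1 _ _ hv hu]
  split_ifs <;> omega

lemma lt_egirth_cycleGraph {m n : ℕ} (hn : 3 ≤ n) (hmn : m < n) :
    (m : ℕ∞) < (cycleGraph n).egirth := by
  -- Potential argument: the offset of a vertex past `v` around the cycle drops by at most 1 along
  -- any edge other than `s(u, v)`. It is `n - 1` at `u` and 0 at `v`.
  have key : ∀ (u v : Fin n), (v.val = u.val + 1 ∨ (v.val = 0 ∧ u.val + 1 = n)) →
      ∀ (x y : Fin n) (p : (cycleGraph n).Walk x y), s(u, v) ∉ p.edges →
        (if v.val ≤ x.val then x.val - v.val else n + x.val - v.val) ≤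
          (if v.val ≤ y.val then y.val - v.val else n + y.val - v.val) + p.length := by
    intro u v huv x y p hp
    induction p with
    | nil => simp
    | @cons x z y hxz p ih =>
      rw [Walk.edges_cons, List.mem_cons, not_or] at hp
      have := ih hp.2
      have hne := hp.1
      rw [cycleGraph_adj_iff_val hn] at hxz
      simp only [Sym2.eq_iff, Fin.ext_iff, not_or, not_and] at hne
      rw [Walk.length_cons]
      have hu := u.2
      have hv := v.2
      have hx := x.2
      have hz := z.2
      have : (if v.val ≤ x.val then x.val - v.val else n + x.val - v.val) ≤
        (if v.val ≤ z.val then z.val - v.val else n + z.val - v.val) + 1 := by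
        split_ifs <;> omega
      omega
  refine lt_egirth_of_forall_le_length fun u v h p hp => ?_
  have hu := u.2
  have hv := v.2
  have main : ∀ (u v : Fin n) (p : (cycleGraph n).Walk u v), s(u, v) ∉ p.edges →
      (v.val = u.val + 1 ∨ (v.val = 0 ∧ u.val + 1 = n)) → m ≤ p.length := by
    intro u v p hp huv
    have := key u v huv u v p hp
    have hu := u.2
    have hv := v.2
    split_ifs at this <;> omega
  rw [cycleGraph_adj_iff_val hn] at h
  have : (v.val = u.val + 1 ∨ (v.val = 0 ∧ u.val + 1 = n)) ∨
      (u.val = v.val + 1 ∨ (u.val = 0 ∧ v.val + 1 = n)) := by omega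
  rcases this with h | h
  · exact main u v p hp h
  · simpa using main v u p.reverse (by simpa [Sym2.eq_swap] using hp) h

end SimpleGraph

namespace SimpleGraph

/-! ### Links of a cyclic join -/

section CyclicJoin

variable {V : Type} {n : ℕ} {G : SimpleGraph V} {A B : Set V}

/-- The edge of `cyclicJoin n G A B f` at the vertex `p.2` of the `p.1`-st copy of `B`. -/
def linkEdge (f : ZMod n → (B ≃ A)) (p : ZMod n × B) : Sym2 (ZMod n × V) :=
  s((p.1, (p.2 : V)), (p.1 + 1, (f p.1 p.2 : V)))

lemma zmod_add_one_ne (hn : 5 ≤ n) (i : ZMod n) : i + 1 ≠ i := by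
  have : Fact (1 < n) := ⟨by omega⟩
  simp

lemma cyclicJoin_adj (hn : 5 ≤ n) {f : ZMod n → (B ≃ A)} {x y : ZMod n × V} :
    (cyclicJoin n G A B f).Adj x y ↔
      (x.1 = y.1 ∧ G.Adj x.2 y.2) ∨ ∃ p, s(x, y) = linkEdge f p := by
  obtain ⟨i, v⟩ := x
  obtain ⟨j, w⟩ := y
  have h1 := zmod_add_one_ne hn
  simp only [cyclicJoin, fromRel_adj, linkEdge]
  constructor
  · rintro ⟨-, (⟨rfl, h⟩ | ⟨rfl, hv, h⟩) | (⟨rfl, h⟩ | ⟨rfl, hv, h⟩)⟩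
    · exact Or.inl ⟨rfl, h⟩
    · exact Or.inr ⟨⟨i, v, hv⟩, by simp [h]⟩
    · exact Or.inl ⟨rfl, h.symm⟩
    · exact Or.inr ⟨⟨j, w, hv⟩, by simp [h, Sym2.eq_swap]⟩
  · rintro (⟨rfl, h⟩ | ⟨⟨k, b⟩, h⟩)
    · exact ⟨fun he => h.ne (Prod.ext_iff.1 he).2, Or.inl (Or.inl ⟨rfl, h⟩)⟩
    · simp only [Sym2.eq_iff, Prod.mk.injEq] at h
      rcases h with ⟨⟨rfl, rfl⟩, rfl, rfl⟩ | ⟨⟨rfl, rfl⟩, rfl, rfl⟩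
      · exact ⟨fun he => h1 i (Prod.ext_iff.1 he).1.symm,
          Or.inl (Or.inr ⟨rfl, b.2, rfl⟩)⟩
      · exact ⟨fun he => h1 j (Prod.ext_iff.1 he).1, Or.inr (Or.inr ⟨rfl, b.2, rfl⟩)⟩

lemma linkEdge_ne_of_fst_eq (hn : 5 ≤ n) {f : ZMod n → (B ≃ A)} {x y : ZMod n × V}
    (h : x.1 = y.1) (p : ZMod n × B) : s(x, y) ≠ linkEdge f p := by
  intro he
  have h1 := zmod_add_one_ne hn p.1
  rcases Sym2.eq_iff.1 he with ⟨rfl, rfl⟩ | ⟨rfl, rfl⟩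
  · exact h1 h.symm
  · exact h1 h

/-- Since `A` and `B` are disjoint, a link has only one end in `B`, and this end determines it. -/
lemma linkEdge_injective (hAB : Disjoint A B) (f : ZMod n → (B ≃ A)) :
    Function.Injective (linkEdge f) := by
  rintro ⟨i, b⟩ ⟨j, c⟩ h
  simp only [linkEdge, Sym2.eq_iff, Prod.mk.injEq] at h
  rcases h with ⟨⟨rfl, h⟩, -⟩ | ⟨⟨-, h⟩, -⟩
  · rw [Subtype.ext h]
  · exact absurd b.2 (Set.disjoint_left.1 hAB (h ▸ (f j c).2))

/-- A closed trail of `cyclicJoin n G A B f` that is not longer than the cycles of `G` uses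
an edge between two copies. -/
lemma exists_linkEdge_mem_edges (hn : 5 ≤ n) {f : ZMod n → (B ≃ A)} {m : ℕ}
    (hG : (m : ℕ∞) < G.egirth) {x : ZMod n × V} {c : (cyclicJoin n G A B f).Walk x x}
    (hc : c.IsCycle) (hl : c.length ≤ m) : ∃ p, linkEdge f p ∈ c.edges := by
  by_contra! hno
  -- The disjoint union of the copies; a cycle without links lives here.
  let L : SimpleGraph (ZMod n × V) :=
    { Adj := fun x y => x.1 = y.1 ∧ G.Adj x.2 y.2
      symm := ⟨fun x y h => ⟨h.1.symm, h.2.symm⟩⟩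
      loopless := ⟨fun x h => h.2.ne rfl⟩ }
  -- Walks of `L` stay in one copy, so projecting to `G` identifies no two edges of such a walk with
  -- each other.
  have hfst : ∀ {x y : ZMod n × V} (p : L.Walk x y), ∀ z ∈ p.support, z.1 = x.1 := by
    intro x y p
    induction p with
    | nil => simp
    | cons h p ih =>
      intro z hz
      rw [Walk.support_cons, List.mem_cons] at hz
      rcases hz with rfl | hz
      · rfl
      · exact (ih z hz).trans h.1.symm
  let φ : L →g G := ⟨Prod.snd, fun h => h.2⟩
  have hL : (m : ℕ∞) < L.egirth := by
    refine lt_egirth_of_forall_le_length fun u v huv p hp => ?_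
    have := le_length_of_lt_egirth hG huv.2 (p.map φ) (by
      intro h
      rw [Walk.edges_map, List.mem_map] at h
      obtain ⟨e, he, hee⟩ := h
      induction e with
      | _ y z =>
        have hy := hfst p y (p.fst_mem_support_of_mem_edges he)
        have hz := hfst p z (p.snd_mem_support_of_mem_edges he)
        rw [Sym2.map_mk, Sym2.eq_iff] at hee
        apply hp
        rcases hee with ⟨h1, h2⟩ | ⟨h1, h2⟩
        · have e1 : y = u := Prod.ext hy h1
          have e2 : z = v := Prod.ext (hz.trans huv.1) h2
          exact (congrArg₂ (fun a b => s(a, b) ∈ p.edges) e1 e2).mp he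
        · have e1 : y = v := Prod.ext (hy.trans huv.1) h1
          have e2 : z = u := Prod.ext hz h2
          rw [Sym2.eq_swap]
          exact (congrArg₂ (fun a b => s(a, b) ∈ p.edges) e1 e2).mp he)
    simpa using this
  have htr : ∀ e ∈ c.edges, e ∈ L.edgeSet := by
    intro e he
    induction e with
    | _ y z =>
      rcases (cyclicJoin_adj hn).1 (c.adj_of_mem_edges he) with h | ⟨p, hp⟩
      · exact h
      · exact absurd (hp ▸ he) (hno p)
  have := hL.trans_le (egirth_le_length (hc.transfer htr))
  rw [Walk.length_transfer] at this
  norm_cast at this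
  omega

/-! ### Switching links -/

/-- Exchanging the images of `b` and `b'` in the `i`-th bijection. -/
noncomputable def switch (f : ZMod n → (B ≃ A)) (i : ZMod n) (b b' : B) : ZMod n → (B ≃ A) :=
  open Classical in Function.update f i ((Equiv.swap b b').trans (f i))

lemma linkEdge_switch_left (f : ZMod n → (B ≃ A)) (i : ZMod n) (b b' : B) :
    linkEdge (switch f i b b') (i, b) = s((i, (b : V)), (i + 1, (f i b' : V))) := by
  simp [linkEdge, switch]

lemma linkEdge_switch_right (f : ZMod n → (B ≃ A)) (i : ZMod n) (b b' : B) :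
    linkEdge (switch f i b b') (i, b') = s((i, (b' : V)), (i + 1, (f i b : V))) := by
  simp [linkEdge, switch]

lemma linkEdge_switch_of_ne (f : ZMod n → (B ≃ A)) (i : ZMod n) (b b' : B) {p : ZMod n × B}
    (h : p ≠ (i, b)) (h' : p ≠ (i, b')) : linkEdge (switch f i b b') p = linkEdge f p := by
  obtain ⟨j, c⟩ := p
  simp only [linkEdge, switch]
  by_cases hj : j = i
  · subst hj
    simp only [ne_eq, Prod.mk.injEq, true_and] at h h'
    classical
    simp only [Function.update_self, Equiv.trans_apply]
    rw [Equiv.swap_apply_of_ne_of_ne h h']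
  · simp [Function.update_of_ne hj]

/-- The edges between copies that lie on a cycle of length at most `m`. -/
def shortLinks (G : SimpleGraph V) (f : ZMod n → (B ≃ A)) (m : ℕ) : Set (ZMod n × B) :=
  {p | ∃ (x : _) (c : (cyclicJoin n G A B f).Walk x x),
    c.IsCycle ∧ c.length ≤ m ∧ linkEdge f p ∈ c.edges}

/-- Switching an edge on a cycle of length `m + 1` with a far edge. -/
lemma lt_egirth_and_shortLinks_switch (hn : 5 ≤ n) (hAB : Disjoint A B) {f : ZMod n → (B ≃ A)}
    {m : ℕ} (hm : (m : ℕ∞) < (cyclicJoin n G A B f).egirth) (i : ZMod n) (b b' : B)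
    (hbb : ∀ p : (cyclicJoin n G A B f).Walk (i, b) (i, b'), m < p.length)
    (hba' : ∀ p : (cyclicJoin n G A B f).Walk (i, b) (i + 1, f i b'), m < p.length)
    (hab' : ∀ p : (cyclicJoin n G A B f).Walk (i + 1, f i b) (i, b'), m < p.length) :
    (m : ℕ∞) < (cyclicJoin n G A B (switch f i b b')).egirth ∧
      shortLinks G (switch f i b b') (m + 1) ⊆ shortLinks G f (m + 1) \ {(i, b)} := by
  set H := cyclicJoin n G A B f with hHdef
  set H' := cyclicJoin n G A B (switch f i b b') with hHdef'
  have hinj := linkEdge_injective hAB f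
  have hbne : b ≠ b' := by
    rintro rfl
    exact absurd (hbb Walk.nil) (by simp)
  have hadj : ∀ c : B, H.Adj (i, (c : V)) (i + 1, (f i c : V)) := fun c =>
    (cyclicJoin_adj hn).2 (Or.inr ⟨(i, c), rfl⟩)
  have hH : ∀ x y, H'.Adj x y →
      (H.Adj x y ∧ s(x, y) ≠ linkEdge f (i, b) ∧ s(x, y) ≠ linkEdge f (i, b')) ∨
        s(x, y) = linkEdge (switch f i b b') (i, b) ∨
        s(x, y) = linkEdge (switch f i b b') (i, b') := by
    intro x y hxy
    rcases (cyclicJoin_adj hn).1 hxy with h | ⟨p, hp⟩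
    · exact Or.inl ⟨(cyclicJoin_adj hn).2 (Or.inl h), linkEdge_ne_of_fst_eq hn h.1 _,
        linkEdge_ne_of_fst_eq hn h.1 _⟩
    · by_cases h : p = (i, b)
      · exact Or.inr (Or.inl (h ▸ hp))
      by_cases h' : p = (i, b')
      · exact Or.inr (Or.inr (h' ▸ hp))
      rw [linkEdge_switch_of_ne f i b b' h h'] at hp
      exact Or.inl ⟨(cyclicJoin_adj hn).2 (Or.inr ⟨p, hp⟩), by rw [hp]; exact hinj.ne h,
        by rw [hp]; exact hinj.ne h'⟩
  have hleft : ∀ {x} {c : H'.Walk x x}, c.IsTrail → c.length ≤ m + 1 →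
      linkEdge (switch f i b b') (i, b) ∉ c.edges := by
    intro x c hc hl
    rw [linkEdge_switch_left]
    refine notMem_edges_of_switch hm (hadj b) (fun x y hxy => ?_) hbb hba' hc hl
    have := hH x y hxy
    rw [linkEdge_switch_left, linkEdge_switch_right] at this
    rcases this with ⟨h, h1, -⟩ | h | h
    · exact Or.inl ⟨h, h1⟩
    · exact Or.inr (Or.inr h)
    · exact Or.inr (Or.inl h)
  have hright : ∀ {x} {c : H'.Walk x x}, c.IsTrail → c.length ≤ m + 1 →
      linkEdge (switch f i b b') (i, b') ∉ c.edges := by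
    intro x c hc hl
    rw [linkEdge_switch_right]
    refine notMem_edges_of_switch hm (hadj b') (fun x y hxy => ?_)
      (fun p => by simpa using hbb p.reverse) (fun p => by simpa using hab' p.reverse) hc hl
    have := hH x y hxy
    rw [linkEdge_switch_left, linkEdge_switch_right] at this
    rcases this with ⟨h, -, h1⟩ | h | h
    · exact Or.inl ⟨h, h1⟩
    · exact Or.inr (Or.inl h)
    · exact Or.inr (Or.inr h)
  -- Short closed trails avoid both new links, so they already exist in `H`.
  have htr : ∀ {x} {c : H'.Walk x x}, c.IsTrail → c.length ≤ m + 1 → ∀ e ∈ c.edges,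
      e ∈ H.edgeSet ∧ e ≠ linkEdge f (i, b) := by
    intro x c hc hl e he
    induction e with
    | _ y z =>
      rcases hH y z (c.adj_of_mem_edges he) with ⟨h, h1, -⟩ | h | h
      · exact ⟨h, h1⟩
      · exact absurd (h ▸ he) (hleft hc hl)
      · exact absurd (h ▸ he) (hright hc hl)
  constructor
  · refine lt_of_lt_of_le (b := ((m + 1 : ℕ) : ℕ∞)) (by norm_cast; omega) (le_egirth.2 ?_)
    intro x c hc
    by_contra! hlt
    norm_cast at hlt
    have := hm.trans_le (egirth_le_length
      (hc.transfer fun e he => (htr hc.isTrail (by omega) e he).1))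
    rw [Walk.length_transfer] at this
    norm_cast at this
    omega
  · rintro p ⟨x, c, hc, hl, hp⟩
    have h1 : p ≠ (i, b) := fun h => hleft hc.isTrail hl (h ▸ hp)
    have h2 : p ≠ (i, b') := fun h => hright hc.isTrail hl (h ▸ hp)
    rw [linkEdge_switch_of_ne f i b b' h1 h2] at hp
    exact ⟨⟨x, _, hc.transfer fun e he => (htr hc.isTrail hl e he).1,
      by rwa [Walk.length_transfer], by rwa [Walk.edges_transfer]⟩, h1⟩

/-- If `B` is large, there is an edge between copies that is far from a given one. -/
lemma exists_far_link [Finite V] (hn : 5 ≤ n) {f : ZMod n → (B ≃ A)} {D m : ℕ}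
    (hD : ∀ v, ((cyclicJoin n G A B f).neighborSet v).ncard ≤ D)
    (hB : 3 * (D + 1) ^ m < B.ncard) (i : ZMod n) (b : B) :
    ∃ b' : B, (∀ p : (cyclicJoin n G A B f).Walk (i, b) (i, b'), m < p.length) ∧
      (∀ p : (cyclicJoin n G A B f).Walk (i, b) (i + 1, f i b'), m < p.length) ∧
      ∀ p : (cyclicJoin n G A B f).Walk (i + 1, f i b) (i, b'), m < p.length := by
  have : NeZero n := ⟨by omega⟩
  set H := cyclicJoin n G A B f
  by_contra! hno
  let S : ZMod n × V → Set (ZMod n × V) := fun x => {y | ∃ p : H.Walk x y, p.length ≤ m}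
  have hS : ∀ x (g : B → ZMod n × V), Function.Injective g →
      (g ⁻¹' S x).ncard ≤ (D + 1) ^ m := by
    intro x g hg
    rw [← Set.ncard_image_of_injective _ hg]
    exact (Set.ncard_le_ncard (Set.image_preimage_subset _ _)).trans
      (ncard_setOf_exists_walk_le hD m x)
  have h1 := hS (i, b) (fun c => (i, c)) fun c c' h => Subtype.ext (Prod.ext_iff.1 h).2
  have h2 := hS (i, b) (fun c => (i + 1, f i c)) fun c c' h =>
    (f i).injective (Subtype.ext (Prod.ext_iff.1 h).2)
  have h3 := hS (i + 1, f i b) (fun c => (i, c)) fun c c' h => Subtype.ext (Prod.ext_iff.1 h).2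
  -- Without a far link, the preimages of three balls of radius `m` would cover `B`; hence the
  -- factor 3.
  have hcov : (Set.univ : Set B) ⊆ ((fun c : B => (i, (c : V))) ⁻¹' S (i, b) ∪
      (fun c : B => (i + 1, (f i c : V))) ⁻¹' S (i, b)) ∪
      (fun c : B => (i, (c : V))) ⁻¹' S (i + 1, f i b) := by
    intro c _
    by_cases ha : ∃ p : H.Walk (i, (b : V)) (i, (c : V)), p.length ≤ m
    · exact Or.inl (Or.inl ha)
    by_cases hb : ∃ p : H.Walk (i, (b : V)) (i + 1, (f i c : V)), p.length ≤ m
    · exact Or.inl (Or.inr hb)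
    push Not at ha hb
    exact Or.inr (hno c ha hb)
  have h4 := Set.ncard_le_ncard hcov
  rw [Set.ncard_univ, Nat.card_coe_set_eq] at h4
  have h5 := Set.ncard_union_le ((fun c : B => (i, (c : V))) ⁻¹' S (i, b) ∪
      (fun c : B => (i + 1, (f i c : V))) ⁻¹' S (i, b))
      ((fun c : B => (i, (c : V))) ⁻¹' S (i + 1, f i b))
  have h6 := Set.ncard_union_le ((fun c : B => (i, (c : V))) ⁻¹' S (i, b))
      ((fun c : B => (i + 1, (f i c : V))) ⁻¹' S (i, b))
  omega

/-- If `G` has large girth and `B` is large, the edges between the copies can be chosen so that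
the girth stays large. -/
lemma exists_lt_egirth_cyclicJoin [Finite V] (hn : 5 ≤ n) (hAB : Disjoint A B) {D g : ℕ}
    (hD : ∀ (f : ZMod n → (B ≃ A)) v, ((cyclicJoin n G A B f).neighborSet v).ncard ≤ D)
    (hG : (g : ℕ∞) < G.egirth) (hB : 3 * (D + 1) ^ g < B.ncard) (e : B ≃ A) :
    ∃ f : ZMod n → (B ≃ A), (g : ℕ∞) < (cyclicJoin n G A B f).egirth := by
  have : NeZero n := ⟨by omega⟩
  suffices h : ∀ m ≤ g, ∃ f : ZMod n → (B ≃ A), (m : ℕ∞) < (cyclicJoin n G A B f).egirth from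
    h g le_rfl
  intro m
  induction m with
  | zero =>
    exact fun _ => ⟨fun _ => e, lt_of_lt_of_le (by norm_num) three_le_egirth⟩
  | succ m ih =>
    intro hmg
    obtain ⟨f, hf⟩ := ih (by omega)
    -- Inner induction on the number of links still on cycles of length at most `m + 1`.
    induction hk : (shortLinks G f (m + 1)).ncard using Nat.strong_induction_on generalizing f with
    | _ k ihk =>
      subst hk
      by_cases hemp : shortLinks G f (m + 1) = ∅
      · refine ⟨f, lt_of_lt_of_le (b := ((m + 2 : ℕ) : ℕ∞)) (by norm_cast; omega)
          (le_egirth.2 fun x c hc => ?_)⟩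
        by_contra! hlt
        norm_cast at hlt
        obtain ⟨p, hp⟩ := exists_linkEdge_mem_edges hn hG hc (by omega)
        exact Set.eq_empty_iff_forall_notMem.1 hemp p ⟨x, c, hc, by omega, hp⟩
      · obtain ⟨⟨i, b⟩, hib⟩ := Set.nonempty_iff_ne_empty.2 hemp
        have hB' : 3 * (D + 1) ^ m < B.ncard :=
          lt_of_le_of_lt (Nat.mul_le_mul_left _ (Nat.pow_le_pow_right (by omega) (by omega))) hB
        obtain ⟨b', h1, h2, h3⟩ := exists_far_link hn (hD f) hB' i b
        obtain ⟨h4, h5⟩ := lt_egirth_and_shortLinks_switch hn hAB hf i b b' h1 h2 h3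
        refine ihk _ (Set.ncard_lt_ncard ?_) _ h4 rfl
        exact (Set.ssubset_iff_of_subset (h5.trans Set.sdiff_subset)).2
          ⟨(i, b), hib, fun h => (h5 h).2 rfl⟩

/-! ### Invariants of the cyclic join -/

lemma IsBipartiteWith.cyclicJoin (hn : 5 ≤ n) (h : G.IsBipartiteWith A B) (f : ZMod n → (B ≃ A)) :
    (cyclicJoin n G A B f).IsBipartiteWith {x | x.2 ∈ A} {x | x.2 ∈ B} := by
  refine ⟨Set.disjoint_left.2 fun x hx hx' => Set.disjoint_left.1 h.disjoint hx hx', ?_⟩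
  intro x y hxy
  rcases (cyclicJoin_adj hn).1 hxy with hin | ⟨p, hp⟩
  · exact h.mem_of_adj hin.2
  · rcases Sym2.eq_iff.1 hp with ⟨rfl, rfl⟩ | ⟨rfl, rfl⟩
    · exact Or.inr ⟨p.2.2, (f p.1 p.2).2⟩
    · exact Or.inl ⟨(f p.1 p.2).2, p.2.2⟩

/-- Each vertex meets exactly one link: to the next copy from `B`, to the preceding copy from `A`.
-/
lemma ncard_neighborSet_cyclicJoin [Finite V] (hn : 5 ≤ n) (hAB : IsCompl A B)
    (f : ZMod n → (B ≃ A)) (x : ZMod n × V) :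
    ((cyclicJoin n G A B f).neighborSet x).ncard = (G.neighborSet x.2).ncard + 1 := by
  have : NeZero n := ⟨by omega⟩
  obtain ⟨i, v⟩ := x
  have hdis := Set.disjoint_left.1 hAB.disjoint
  have key : ∃ y : ZMod n × V, y.1 ≠ i ∧
      (cyclicJoin n G A B f).neighborSet (i, v) = insert y (Prod.mk i '' G.neighborSet v) := by
    have hv : v ∈ A ∪ B := by
      have : A ∪ B = Set.univ := hAB.sup_eq_top
      exact this ▸ Set.mem_univ v
    rcases hv with hv | hv
    · refine ⟨(i - 1, (f (i - 1)).symm ⟨v, hv⟩), fun h => ?_, ?_⟩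
      · exact zmod_add_one_ne hn (i - 1) (by simpa using h.symm)
      · ext ⟨j, w⟩
        rw [mem_neighborSet, cyclicJoin_adj hn]
        simp only [Set.mem_insert_iff, Set.mem_image, Prod.mk.injEq, mem_neighborSet]
        constructor
        · rintro (⟨rfl, h⟩ | ⟨⟨k, b⟩, hp⟩)
          · exact Or.inr ⟨w, h, rfl, rfl⟩
          · simp only [linkEdge, Sym2.eq_iff, Prod.mk.injEq] at hp
            rcases hp with ⟨⟨rfl, rfl⟩, rfl, rfl⟩ | ⟨⟨rfl, rfl⟩, rfl, rfl⟩
            · exact absurd b.2 (hdis hv)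
            · left
              simp
        · rintro (⟨rfl, rfl⟩ | ⟨_, h, rfl, rfl⟩)
          · exact Or.inr ⟨(i - 1, (f (i - 1)).symm ⟨v, hv⟩), by simp [linkEdge, Sym2.eq_swap]⟩
          · exact Or.inl ⟨rfl, h⟩
    · refine ⟨(i + 1, f i ⟨v, hv⟩), zmod_add_one_ne hn i, ?_⟩
      ext ⟨j, w⟩
      rw [mem_neighborSet, cyclicJoin_adj hn]
      simp only [Set.mem_insert_iff, Set.mem_image, Prod.mk.injEq, mem_neighborSet]
      constructor
      · rintro (⟨rfl, h⟩ | ⟨⟨k, b⟩, hp⟩)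
        · exact Or.inr ⟨w, h, rfl, rfl⟩
        · simp only [linkEdge, Sym2.eq_iff, Prod.mk.injEq] at hp
          rcases hp with ⟨⟨rfl, rfl⟩, rfl, rfl⟩ | ⟨⟨rfl, rfl⟩, rfl, rfl⟩
          · exact Or.inl ⟨rfl, rfl⟩
          · exact absurd hv (hdis (f _ b).2)
      · rintro (⟨rfl, rfl⟩ | ⟨_, h, rfl, rfl⟩)
        · exact Or.inr ⟨(i, ⟨v, hv⟩), rfl⟩
        · exact Or.inl ⟨rfl, h⟩
  obtain ⟨y, hy, he⟩ := key
  rw [he, Set.ncard_insert_of_notMem, Set.ncard_image_of_injective _ (Prod.mk_right_injective i)]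
  rintro ⟨w, -, rfl⟩
  exact hy rfl

lemma not_isAcyclic_cyclicJoin (hn : 5 ≤ n) (h : ¬ G.IsAcyclic) (f : ZMod n → (B ≃ A)) :
    ¬ (cyclicJoin n G A B f).IsAcyclic := by
  intro h'
  let φ : G →g cyclicJoin n G A B f :=
    ⟨Prod.mk 0, fun hvw => (cyclicJoin_adj hn).2 (Or.inl ⟨rfl, hvw⟩)⟩
  exact h (h'.comap φ (Prod.mk_right_injective 0))

end CyclicJoin

end SimpleGraph

open SimpleGraph

/-! ### The induction on the degree -/

/-- Every degree occurs in the construction with large girth and large partition classes. -/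
lemma exists_constructed_lt_egirth (d : ℕ) (hd : 2 ≤ d) (g N : ℕ) :
    ∃ (V : Type) (_ : Finite V) (G : SimpleGraph V) (A B : Set V), Constructed d G A B ∧
      G.IsBipartiteWith A B ∧ IsCompl A B ∧ Nonempty (B ≃ A) ∧ N ≤ B.ncard ∧
      (∀ v, (G.neighborSet v).ncard = d) ∧ ¬ G.IsAcyclic ∧ (g : ℕ∞) < G.egirth := by
  induction d, hd using Nat.le_induction generalizing g N with
  | base =>
    obtain ⟨k, hk5, hkg, hkN⟩ : ∃ k, 5 ≤ k ∧ g ≤ k ∧ N ≤ k :=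
      ⟨5 + g + N, by omega, by omega, by omega⟩
    let ψ : Fin k ≃ {v : Fin (2 * k) | Odd v.val} :=
      { toFun := fun j => ⟨⟨2 * j.val + 1, by omega⟩, by simp⟩
        invFun := fun v => ⟨v.1.val / 2, by omega⟩
        left_inv := fun j => by ext; simp; omega
        right_inv := fun ⟨v, hv⟩ => by
          obtain ⟨r, hr⟩ := hv
          ext
          simp [hr]
          omega }
    let χ : Fin k ≃ {v : Fin (2 * k) | Even v.val} :=
      { toFun := fun j => ⟨⟨2 * j.val, by omega⟩, by simp⟩
        invFun := fun v => ⟨v.1.val / 2, by omega⟩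
        left_inv := fun j => by ext; simp
        right_inv := fun ⟨v, hv⟩ => by
          obtain ⟨r, hr⟩ := hv
          ext
          simp [hr]
          omega }
    have hcompl : IsCompl {v : Fin (2 * k) | Even v.val} {v : Fin (2 * k) | Odd v.val} := by
      have : {v : Fin (2 * k) | Odd v.val} = {v : Fin (2 * k) | Even v.val}ᶜ := by
        ext v; simp
      rw [this]
      exact isCompl_compl
    refine ⟨Fin (2 * k), inferInstance, cycleGraph (2 * k), _, _,
      Constructed.cycle (2 * k) (by omega) (even_two_mul k), ⟨hcompl.disjoint, ?_⟩, hcompl,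
      ⟨ψ.symm.trans χ⟩, ?_, ?_, ?_, lt_egirth_cycleGraph (by omega) (by omega)⟩
    · intro u v h
      rw [cycleGraph_adj_iff_val (by omega)] at h
      simp only [Set.mem_ofPred_eq, Nat.even_iff, Nat.odd_iff]
      omega
    · rw [← Nat.card_coe_set_eq, ← Nat.card_congr ψ, Nat.card_fin]
      exact hkN
    · intro v
      obtain ⟨j, hj⟩ : ∃ j, 2 * k = j + 3 := ⟨2 * k - 3, by omega⟩
      revert v
      rw [hj]
      intro v
      rw [← cycleGraph_degree_three_le (v := v), ← card_neighborSet_eq_degree,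
        ← Nat.card_coe_set_eq, Nat.card_eq_fintype_card]
    · obtain ⟨j, hj⟩ : ∃ j, 2 * k = j + 3 := ⟨2 * k - 3, by omega⟩
      rw [hj]
      exact fun h => h _ (cycleGraph.isCycle_cycle (n := j))
  | succ d hd ih =>
    obtain ⟨V, _, G, A, B, hC, hbip, hcompl, ⟨e⟩, hB, hdeg, hac, hg⟩ :=
      -- The join has degree `D = d + 1`, so `3 * (D + 1) ^ g` is the bound that `B` must exceed;
      -- `N` passes on the size demand.
      ih g (N + 3 * (d + 1 + 1) ^ g + 1)
    have hn : 5 ≤ 5 := le_rfl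
    have hdeg' : ∀ (f : ZMod 5 → (B ≃ A)) v, ((cyclicJoin 5 G A B f).neighborSet v).ncard = d + 1 :=
      fun f v => by rw [ncard_neighborSet_cyclicJoin hn hcompl, hdeg]
    obtain ⟨f, hf⟩ := exists_lt_egirth_cyclicJoin hn hcompl.disjoint
      (fun f v => (hdeg' f v).le) hg (by omega) e
    refine ⟨ZMod 5 × V, inferInstance, cyclicJoin 5 G A B f, _, _,
      Constructed.step d G A B hC 5 hn f, hbip.cyclicJoin hn f, ?_, ⟨?_⟩, ?_, hdeg' f,
      not_isAcyclic_cyclicJoin hn hac f, hf⟩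
    · have : B = Aᶜ := hcompl.compl_eq.symm
      subst this
      exact isCompl_compl
    · exact
        { toFun := fun x => ⟨(x.1.1, e ⟨x.1.2, x.2⟩), (e ⟨x.1.2, x.2⟩).2⟩
          invFun := fun x => ⟨(x.1.1, e.symm ⟨x.1.2, x.2⟩), (e.symm ⟨x.1.2, x.2⟩).2⟩
          left_inv := fun x => by simp
          right_inv := fun x => by simp }
    · have : Prod.mk (0 : ZMod 5) '' B ⊆ {x | x.2 ∈ B} := by
        rintro _ ⟨b, hb, rfl⟩
        exact hb
      have := Set.ncard_le_ncard this
      rw [Set.ncard_image_of_injective _ (Prod.mk_right_injective _)] at this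
      omega

theorem theorem5p3 (d : ℕ) (hd : 2 ≤ d) (g : ℕ) :
    ∃ (V : Type) (_ : Fintype V) (G : SimpleGraph V) (_ : G.LocallyFinite),
      InFamily d G ∧ G.IsRegularOfDegree d ∧ G.IsBipartite ∧
        ¬ G.IsAcyclic ∧ g < G.girth := by
  classical
  obtain ⟨V, _, G, A, B, hC, hbip, -, -, -, hdeg, hac, hg⟩ := exists_constructed_lt_egirth d hd g 0
  refine ⟨V, Fintype.ofFinite V, G, fun v => Fintype.ofFinite _, ⟨V, G, A, B, hC, ⟨Iso.refl⟩⟩,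
    fun v => ?_, hbip.isBipartite, hac, ?_⟩
  · let _ : Fintype (G.neighborSet v) := Fintype.ofFinite _
    rw [← hdeg v, ← card_neighborSet_eq_degree, ← Nat.card_coe_set_eq, Nat.card_eq_fintype_card]
  -- `girth` is 0 for acyclic graphs, so the bound on `egirth` transfers only because a cycle
  -- exists.
  · obtain ⟨x, c, hc, hl⟩ := exists_girth_eq_length.2 hac
    have := hg.trans_le (egirth_le_length hc)
    rw [hl]
    exact_mod_cast this
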